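/- Let $\Sigma$ be a compact connected Riemann surface with canonical bundle $K$, let $L=K^{-1/2}$ be a holomorphic line bundle with $L\otimes L\cong K^{-1}$, let $n\ge 1$, and let $(U,\theta)$ be a holomorphic symplectic vector bundle of rank $2n-2$ on $\Sigma$. Let $$0\to L\to E\to U\to 0,\qquad 0\to E\to V\xrightarrow{\ q\ } L^{-1}\to 0$$ be extensions of holomorphic vector bundles, with classes $\delta\in\operatorname{Ext}^1(U,L)\cong H^1(\Sigma,U^*\otimes L)$ and $\widetilde\delta\in\operatorname{Ext}^1(L^{-1},E)\cong H^1(\Sigma,E\otimes L)$; here the class of an extension $0\to A\to F\to B\to 0$ is represented by the Čech cocycle $\sigma_j-\sigma_i$ of differences of local splittings $\sigma_i\colon B\to F$. Let $\theta^\flat\colon U\to U^*$, $u\mapsto\theta(u,\cdot)$, and let the $\theta$-dual $\delta^\theta\in\operatorname{Ext}^1(L^{-1},U)\cong H^1(\Sigma,U\otimes L)$ be the image of $\delta$ under $(\theta^\flat)^{-1}\otimes\operatorname{id}_L\colon U^*\otimes L\to U\otimes L$. Equivalently, if $\delta$ is represented by a cocycle $c_{ij}\colon U\to L$, then $\delta^\theta$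 is represented by the cocycle $c^\theta_{ij}\colon L^{-1}\to U$ with $\theta(c^\theta_{ij}(s),u)=\langle c_{ij}(u),s\rangle$, where $\langle\,,\rangle\colon L\otimes L^{-1}\to\mathcal O_\Sigma$ is the natural pairing. Then $V$ carries a holomorphic symplectic form $\omega$ such that $L^\perp=E$, such that the form induced by $\omega$ on $E/L\cong U$ is $\theta$, and such that the identification $V/E\cong L^{-1}$ given by $q$ is the one induced by $\omega$, that is, $\omega(\ell,v)=\langle\ell,q(v)\rangle$ for all $\ell\in L$ and $v\in V$, if and only if the image of $\widetilde\delta$ under $\operatorname{Ext}^1(L^{-1},E)\to\operatorname{Ext}^1(L^{-1},U)$ is $\delta^\theta$. -/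

import Mathlib

open Bundle Set
open scoped Manifold ContDiff Topology

universe u v w w₁ w₂

/-- A holomorphic vector bundle of finite rank over `X`: an analytic (`ω`) vector bundle in the
sense of Mathlib, over the complex numbers, bundled with its model fibre. -/
structure HolBundle (X : Type u) [TopologicalSpace X] [ChartedSpace ℂ X] where
  Model : Type v
  Fiber : X → Type v
  [normed : NormedAddCommGroup Model]
  [normedSpace : NormedSpace ℂ Model]
  [finiteDim : FiniteDimensional ℂ Model]
  [addCommGroup : ∀ x, AddCommGroup (Fiber x)]
  [module : ∀ x, Module ℂ (Fiber x)]
  [topFiber : ∀ x, TopologicalSpace (Fiber x)]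
  [topAddGroup : ∀ x, IsTopologicalAddGroup (Fiber x)]
  [contSMul : ∀ x, ContinuousSMul ℂ (Fiber x)]
  [topTotal : TopologicalSpace (TotalSpace Model Fiber)]
  [fiberBundle : FiberBundle Model Fiber]
  [vectorBundle : VectorBundle ℂ Model Fiber]
  [holomorphic : ContMDiffVectorBundle ω Model Fiber 𝓘(ℂ)]

namespace HolBundle

attribute [instance] normed normedSpace finiteDim addCommGroup module topFiber topAddGroup contSMul
  topTotal fiberBundle vectorBundle holomorphic

noncomputable section Basic

variable {X : Type u} [TopologicalSpace X] [ChartedSpace ℂ X]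

/-- The rank of a vector bundle. -/
def rank (A : HolBundle.{u, v} X) : ℕ := Module.finrank ℂ A.Model

/-- The bundle `Hom(A, B)`. -/
abbrev hom (A : HolBundle.{u, v} X) (B : HolBundle.{u, w} X) :
    HolBundle.{u, max v w} X where
  Model := A.Model →L[ℂ] B.Model
  Fiber x := A.Fiber x →L[ℂ] B.Fiber x

/-- The dual bundle `A* = Hom(A, 𝒪)`; for a line bundle this is `A⁻¹`. -/
abbrev dual (A : HolBundle.{u, v} X) : HolBundle.{u, v} X where
  Model := A.Model →L[ℂ] ℂ
  Fiber x := A.Fiber x →L[ℂ] ℂ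
  topTotal := Bundle.ContinuousLinearMap.topologicalSpaceTotalSpace
    (RingHom.id ℂ) A.Model A.Fiber ℂ (Bundle.Trivial X ℂ)
  fiberBundle := Bundle.ContinuousLinearMap.fiberBundle
    (RingHom.id ℂ) A.Model A.Fiber ℂ (Bundle.Trivial X ℂ)
  vectorBundle := Bundle.ContinuousLinearMap.vectorBundle
    (RingHom.id ℂ) A.Model A.Fiber ℂ (Bundle.Trivial X ℂ)
  holomorphic := ContMDiffVectorBundle.continuousLinearMap (E₂ := Bundle.Trivial X ℂ)

/-- The holomorphic tangent bundle; on a Riemann surface it is `K⁻¹`. -/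
abbrev tangent (X : Type u) [TopologicalSpace X] [ChartedSpace ℂ X]
    [IsManifold 𝓘(ℂ) ω X] : HolBundle.{u, 0} X where
  Model := ℂ
  Fiber x := TangentSpace 𝓘(ℂ) x

variable {A : HolBundle.{u, v} X} {B : HolBundle.{u, w} X} {C : HolBundle.{u, w₁} X}

/-- The family of fibre maps `φ x : A x → B x` is holomorphic on `W`: it is a holomorphic section
of the bundle `Hom(A, B)` there. -/
def IsHolOn (W : Set X) (φ : ∀ x, A.Fiber x →L[ℂ] B.Fiber x) : Prop :=
  ContMDiffOn 𝓘(ℂ) (𝓘(ℂ).prod 𝓘(ℂ, A.Model →L[ℂ] B.Model)) ω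
    (fun x => TotalSpace.mk' (A.Model →L[ℂ] B.Model)
      (E := fun x => A.Fiber x →L[ℂ] B.Fiber x) x (φ x)) W

/-- The matrix of a family of fibre maps, in the preferred trivialisations at `x₀`. -/
def coord (φ : ∀ x, A.Fiber x →L[ℂ] B.Fiber x) (x₀ x : X) :
    A.Model →L[ℂ] B.Model :=
  ContinuousLinearMap.inCoordinates A.Model A.Fiber B.Model B.Fiber x₀ x x₀ x (φ x)

/-- The domain of the preferred trivialisation at `x₀`. -/
def triv (A : HolBundle.{u, v} X) (x₀ : X) : Set X :=
  (trivializationAt A.Model A.Fiber x₀).baseSet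

theorem triv_mem (A : HolBundle.{u, v} X) (x₀ : X) : A.triv x₀ ∈ 𝓝 x₀ :=
  (trivializationAt A.Model A.Fiber x₀).open_baseSet.mem_nhds
    (FiberBundle.mem_baseSet_trivializationAt' x₀)

/-- The preferred trivialisation at `x₀`, on the fibre at `x`. -/
def chart (A : HolBundle.{u, v} X) (x₀ : X) {x : X} (hx : x ∈ A.triv x₀) :
    A.Fiber x ≃L[ℂ] A.Model :=
  (trivializationAt A.Model A.Fiber x₀).continuousLinearEquivAt ℂ x hx

theorem coord_eq (φ : ∀ x, A.Fiber x →L[ℂ] B.Fiber x) {x₀ x : X} (hA : x ∈ A.triv x₀)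
    (hB : x ∈ B.triv x₀) :
    coord φ x₀ x = (B.chart x₀ hB : B.Fiber x →L[ℂ] B.Model) ∘L φ x ∘L
      ((A.chart x₀ hA).symm : A.Model →L[ℂ] A.Fiber x) :=
  ContinuousLinearMap.inCoordinates_eq hA hB

theorem isHolOn_iff {W : Set X} (φ : ∀ x, A.Fiber x →L[ℂ] B.Fiber x) :
    IsHolOn W φ ↔ ∀ x₀ ∈ W, ContMDiffWithinAt 𝓘(ℂ) 𝓘(ℂ, A.Model →L[ℂ] B.Model) ω
      (coord φ x₀) W x₀ := by
  refine forall₂_congr fun x₀ _ => ?_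
  rw [contMDiffWithinAt_hom_bundle]
  exact and_iff_right contMDiffWithinAt_id

theorem IsHolOn.mono {W W' : Set X} {φ : ∀ x, A.Fiber x →L[ℂ] B.Fiber x} (h : IsHolOn W φ)
    (hW : W' ⊆ W) : IsHolOn W' φ :=
  ContMDiffOn.mono h hW

theorem IsHolOn.congr {W : Set X} {φ ψ : ∀ x, A.Fiber x →L[ℂ] B.Fiber x} (h : IsHolOn W φ)
    (hW : ∀ x ∈ W, ψ x = φ x) : IsHolOn W ψ :=
  ContMDiffOn.congr h fun x hx => by rw [hW x hx]

theorem IsHolOn.add {W : Set X} {φ ψ : ∀ x, A.Fiber x →L[ℂ] B.Fiber x} (h : IsHolOn W φ)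
    (h' : IsHolOn W ψ) : IsHolOn W (fun x => φ x + ψ x) :=
  ContMDiffOn.add_section (V := fun x => A.Fiber x →L[ℂ] B.Fiber x) h h'

theorem IsHolOn.smul {W : Set X} {φ : ∀ x, A.Fiber x →L[ℂ] B.Fiber x} (c : ℂ) (h : IsHolOn W φ) :
    IsHolOn W (fun x => c • φ x) :=
  ContMDiffOn.const_smul_section (V := fun x => A.Fiber x →L[ℂ] B.Fiber x) h

theorem isHolOn_zero (W : Set X) : IsHolOn W (fun x => (0 : A.Fiber x →L[ℂ] B.Fiber x)) := by
  rw [isHolOn_iff]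
  intro x₀ _
  have : coord (fun x => (0 : A.Fiber x →L[ℂ] B.Fiber x)) x₀ = fun _ => 0 := by
    ext x m; simp [coord, ContinuousLinearMap.inCoordinates]
  rw [this]
  exact contMDiffWithinAt_const

/-- A criterion by germs of coordinate matrices. -/
theorem IsHolOn.of_coord {W : Set X} {φ : ∀ x, A.Fiber x →L[ℂ] B.Fiber x}
    (h : ∀ x₀ ∈ W, ∃ f : X → A.Model →L[ℂ] B.Model,
      ContMDiffWithinAt 𝓘(ℂ) 𝓘(ℂ, A.Model →L[ℂ] B.Model) ω f W x₀ ∧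
      ∀ x (_ : x ∈ W) (hA : x ∈ A.triv x₀) (hB : x ∈ B.triv x₀),
        f x = (B.chart x₀ hB : B.Fiber x →L[ℂ] B.Model) ∘L φ x ∘L
      ((A.chart x₀ hA).symm : A.Model →L[ℂ] A.Fiber x)) : IsHolOn W φ := by
  rw [isHolOn_iff]
  intro x₀ hx₀
  obtain ⟨f, hf, hfe⟩ := h x₀ hx₀
  refine hf.congr_of_eventuallyEq_of_mem ?_ hx₀
  filter_upwards [nhdsWithin_le_nhds (A.triv_mem x₀), nhdsWithin_le_nhds (B.triv_mem x₀),
    self_mem_nhdsWithin] with x hA hB hx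
  rw [coord_eq φ hA hB, hfe x hx hA hB]

theorem IsHolOn.comp {W : Set X} {φ : ∀ x, A.Fiber x →L[ℂ] B.Fiber x}
    {ψ : ∀ x, B.Fiber x →L[ℂ] C.Fiber x} (hψ : IsHolOn W ψ) (hφ : IsHolOn W φ) :
    IsHolOn W (fun x => ψ x ∘L φ x) := by
  rw [isHolOn_iff] at hψ hφ ⊢
  intro x₀ hx₀
  refine ((hψ x₀ hx₀).clm_comp (hφ x₀ hx₀)).congr_of_eventuallyEq_of_mem ?_ hx₀
  filter_upwards [nhdsWithin_le_nhds (A.triv_mem x₀), nhdsWithin_le_nhds (B.triv_mem x₀),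
    nhdsWithin_le_nhds (C.triv_mem x₀)] with x hA hB hC
  rw [coord_eq _ hA hB, coord_eq _ hB hC, coord_eq _ hA hC]
  ext m
  simp

theorem isHolOn_id (W : Set X) : IsHolOn W (fun x => ContinuousLinearMap.id ℂ (A.Fiber x)) :=
  IsHolOn.of_coord fun x₀ _ => ⟨fun _ => ContinuousLinearMap.id ℂ A.Model,
    contMDiffWithinAt_const, fun x _ hA hB => by ext m; simp⟩

/-- Transposition of a holomorphic family of fibre maps. -/
theorem dual_triv (A : HolBundle.{u, v} X) {x₀ x : X} (hx : x ∈ A.dual.triv x₀) : x ∈ A.triv x₀ :=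
  hx.1

theorem dual_chart_apply (A : HolBundle.{u, v} X) {x₀ x : X} (hx : x ∈ A.dual.triv x₀)
    (s : A.dual.Fiber x) :
    (A.dual.chart x₀ hx s : A.Model →L[ℂ] ℂ) =
      s ∘L ((A.chart x₀ (A.dual_triv hx)).symm : A.Model →L[ℂ] A.Fiber x) := by
  have h1 : (A.dual.chart x₀ hx s : A.Model →L[ℂ] ℂ) =
      ContinuousLinearMap.inCoordinates A.Model A.Fiber ℂ (Bundle.Trivial X ℂ) x₀ x x₀ x s := rfl
  rw [h1, ContinuousLinearMap.inCoordinates_eq (A.dual_triv hx) (mem_univ x)]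
  ext m
  rfl

theorem IsHolOn.transpose {W : Set X} {φ : ∀ x, A.Fiber x →L[ℂ] B.Fiber x} (hφ : IsHolOn W φ) :
    IsHolOn (A := B.dual) (B := A.dual) W
      (fun x => (ContinuousLinearMap.precomp ℂ (φ x) : _ →L[ℂ] _)) := by
  refine IsHolOn.of_coord fun x₀ hx₀ =>
    ⟨fun x => (ContinuousLinearMap.compL ℂ A.Model B.Model ℂ).flip (coord φ x₀ x), ?_, ?_⟩
  · exact (ContinuousLinearMap.contMDiff _).contMDiffAt.comp_contMDiffWithinAt x₀
      ((isHolOn_iff φ).1 hφ x₀ hx₀)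
  · intro x _ hB hA
    ext s : 1
    obtain ⟨t, rfl⟩ := (B.dual.chart x₀ hB).surjective s
    simp only [ContinuousLinearMap.comp_apply, ContinuousLinearEquiv.coe_coe,
      ContinuousLinearEquiv.symm_apply_apply]
    rw [dual_chart_apply, dual_chart_apply, coord_eq φ (A.dual_triv hA) (B.dual_triv hB)]
    ext m
    simp

theorem IsHolOn.inverse {W : Set X} {φ : ∀ x, A.Fiber x →L[ℂ] B.Fiber x} (hφ : IsHolOn W φ)
    (hi : ∀ x ∈ W, (φ x).IsInvertible) : IsHolOn W (fun x => (φ x).inverse) := by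
  rw [isHolOn_iff] at hφ ⊢
  intro x₀ hx₀
  have h1 := hφ x₀ hx₀
  have hinv : (coord φ x₀ x₀).IsInvertible := by
    rw [coord_eq φ (mem_of_mem_nhds (A.triv_mem x₀)) (mem_of_mem_nhds (B.triv_mem x₀))]
    exact ContinuousLinearMap.isInvertible_equiv.comp
      ((hi x₀ hx₀).comp ContinuousLinearMap.isInvertible_equiv)
  have h2 := (hinv.contDiffAt_map_inverse (n := ω)).contMDiffAt.comp_contMDiffWithinAt x₀ h1
  refine h2.congr_of_eventuallyEq_of_mem ?_ hx₀
  filter_upwards [nhdsWithin_le_nhds (A.triv_mem x₀), nhdsWithin_le_nhds (B.triv_mem x₀)]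
    with x hA hB
  rw [Function.comp_apply, coord_eq _ hA hB, coord_eq _ hB hA]
  simp only [ContinuousLinearMap.inverse_equiv_comp, ContinuousLinearMap.inverse_comp_equiv,
    ContinuousLinearEquiv.symm_symm]
  rfl

/-- A family of fibre maps extends from a point. -/
theorem exists_local_extension (x₀ : X) (T : A.Fiber x₀ →L[ℂ] B.Fiber x₀) :
    ∃ φ : ∀ x, A.Fiber x →L[ℂ] B.Fiber x, ∃ W : Set X, IsOpen W ∧ x₀ ∈ W ∧ IsHolOn W φ ∧
      φ x₀ = T := by
  classical
  have hA₀ := mem_of_mem_nhds (A.triv_mem x₀)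
  have hB₀ := mem_of_mem_nhds (B.triv_mem x₀)
  let T' : A.Model →L[ℂ] B.Model := (B.chart x₀ hB₀ : B.Fiber x₀ →L[ℂ] B.Model) ∘L T ∘L
      ((A.chart x₀ hA₀).symm : A.Model →L[ℂ] A.Fiber x₀)
  let φ : ∀ x, A.Fiber x →L[ℂ] B.Fiber x := fun x =>
    if h : x ∈ A.triv x₀ ∧ x ∈ B.triv x₀ then
      ((B.chart x₀ h.2).symm : B.Model →L[ℂ] B.Fiber x) ∘L T' ∘L
        (A.chart x₀ h.1 : A.Fiber x →L[ℂ] A.Model) else 0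
  have hc : ∀ x (hA : x ∈ A.triv x₀) (hB : x ∈ B.triv x₀), φ x =
      ((B.chart x₀ hB).symm : B.Model →L[ℂ] B.Fiber x) ∘L T' ∘L
        (A.chart x₀ hA : A.Fiber x →L[ℂ] A.Model) := fun x hA hB => dif_pos ⟨hA, hB⟩
  refine ⟨φ, A.triv x₀ ∩ B.triv x₀, ?_, ⟨hA₀, hB₀⟩, ?_, ?_⟩
  · exact (trivializationAt A.Model A.Fiber x₀).open_baseSet.inter
      (trivializationAt B.Model B.Fiber x₀).open_baseSet
  · intro x hx
    refine ((Trivialization.contMDiffAt_section_iff (IB := 𝓘(ℂ)) (n := ω)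
      (F := A.Model →L[ℂ] B.Model) (E := fun x => A.Fiber x →L[ℂ] B.Fiber x)
      (trivializationAt (A.Model →L[ℂ] B.Model) (fun x => A.Fiber x →L[ℂ] B.Fiber x) x₀)
      (x₀ := x) hx).2 ?_).contMDiffWithinAt
    refine (contMDiffAt_const (c := T')).congr_of_eventuallyEq ?_
    have ho : A.triv x₀ ∩ B.triv x₀ ∈ 𝓝 x :=
      ((trivializationAt A.Model A.Fiber x₀).open_baseSet.inter
      (trivializationAt B.Model B.Fiber x₀).open_baseSet).mem_nhds hx
    filter_upwards [ho] with y hy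
    change coord φ x₀ y = T'
    rw [coord_eq φ hy.1 hy.2, hc y hy.1 hy.2]
    ext m
    simp
  · rw [hc x₀ hA₀ hB₀]
    ext m
    simp [T']

theorem IsHolOn.eventually_invertible {W : Set X} (hW : IsOpen W)
    {φ : ∀ x, A.Fiber x →L[ℂ] B.Fiber x} (hφ : IsHolOn W φ) {x₀ : X} (hx₀ : x₀ ∈ W)
    (hi : (φ x₀).IsInvertible) : ∀ᶠ x in 𝓝 x₀, (φ x).IsInvertible := by
  have h1 := ((isHolOn_iff φ).1 hφ x₀ hx₀).continuousWithinAt.continuousAt (hW.mem_nhds hx₀)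
  obtain ⟨e, he⟩ : (coord φ x₀ x₀).IsInvertible := by
    rw [coord_eq φ (mem_of_mem_nhds (A.triv_mem x₀)) (mem_of_mem_nhds (B.triv_mem x₀))]
    exact ContinuousLinearMap.isInvertible_equiv.comp
      (hi.comp ContinuousLinearMap.isInvertible_equiv)
  have h2 := h1 (he ▸ ContinuousLinearEquiv.nhds e)
  filter_upwards [h2, A.triv_mem x₀, B.triv_mem x₀] with x hx hA hB
  obtain ⟨e', he'⟩ := hx
  rw [coord_eq φ hA hB] at he'
  refine ⟨((A.chart x₀ hA).trans e').trans (B.chart x₀ hB).symm, ?_⟩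
  ext m
  have := DFunLike.congr_fun he' (A.chart x₀ hA m)
  simp only [ContinuousLinearMap.comp_apply, ContinuousLinearEquiv.coe_coe,
    ContinuousLinearEquiv.symm_apply_apply] at this
  simp [this]

theorem IsHolOn.of_local {W : Set X} {φ : ∀ x, A.Fiber x →L[ℂ] B.Fiber x}
    (h : ∀ x ∈ W, ∃ W' : Set X, IsOpen W' ∧ x ∈ W' ∧ IsHolOn (W ∩ W') φ) : IsHolOn W φ :=
  contMDiffOn_of_locally_contMDiffOn h

instance (A : HolBundle.{u, v} X) (x : X) : T2Space (A.Fiber x) :=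
  (A.chart x (mem_of_mem_nhds (A.triv_mem x))).toHomeomorph.symm.t2Space

instance (A : HolBundle.{u, v} X) (x : X) : FiniteDimensional ℂ (A.Fiber x) :=
  (A.chart x (mem_of_mem_nhds (A.triv_mem x))).symm.toLinearEquiv.finiteDimensional

theorem isInvertible_of_bijective {x : X} {f : A.Fiber x →L[ℂ] B.Fiber x}
    (hf : Function.Bijective f) : f.IsInvertible :=
  ⟨(LinearEquiv.ofBijective (f : A.Fiber x →ₗ[ℂ] B.Fiber x) hf).toContinuousLinearEquiv, by
    ext; rfl⟩

end Basic

noncomputable section Hom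

variable {X : Type u} [TopologicalSpace X] [ChartedSpace ℂ X]

/-- A morphism of holomorphic vector bundles. -/
structure Morphism (A : HolBundle.{u, v} X) (B : HolBundle.{u, w} X) where
  toFun : ∀ x, A.Fiber x →L[ℂ] B.Fiber x
  isHol : IsHolOn univ toFun

instance (A : HolBundle.{u, v} X) (B : HolBundle.{u, w} X) :
    CoeFun (Morphism A B) (fun _ => ∀ x, A.Fiber x →L[ℂ] B.Fiber x) := ⟨Morphism.toFun⟩

variable {A : HolBundle.{u, v} X} {B : HolBundle.{u, w} X} {C : HolBundle.{u, w₁} X}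

theorem Morphism.exists_local_section (p : Morphism A B) (hp : ∀ x, Function.Surjective (p x))
    (x₀ : X) : ∃ (W : Set X) (s : ∀ x, B.Fiber x →L[ℂ] A.Fiber x), IsOpen W ∧ x₀ ∈ W ∧
      IsHolOn W s ∧ ∀ x ∈ W, p x ∘L s x = ContinuousLinearMap.id ℂ _ := by
  obtain ⟨g, hg⟩ := LinearMap.exists_rightInverse_of_surjective (p x₀ : A.Fiber x₀ →ₗ[ℂ] B.Fiber x₀)
    (LinearMap.range_eq_top.2 (hp x₀))
  obtain ⟨t, W, hW, hxW, ht, htx⟩ := exists_local_extension x₀ (LinearMap.toContinuousLinearMap g)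
  have hpt : IsHolOn W (fun x => p x ∘L t x) := (p.isHol.mono (subset_univ _)).comp ht
  have hi : (p x₀ ∘L t x₀).IsInvertible := by
    refine ⟨ContinuousLinearEquiv.refl ℂ _, ?_⟩
    ext m
    rw [htx]
    exact (LinearMap.congr_fun hg m).symm
  obtain ⟨W', hW's, hW', hxW'⟩ := mem_nhds_iff.1 (hpt.eventually_invertible hW hxW hi)
  refine ⟨W ∩ W', fun x => t x ∘L (p x ∘L t x).inverse, hW.inter hW', ⟨hxW, hxW'⟩, ?_, ?_⟩
  · exact (ht.mono inter_subset_left).comp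
      ((hpt.mono inter_subset_left).inverse fun x hx => hW's hx.2)
  · intro x hx
    rw [← ContinuousLinearMap.comp_assoc]
    exact (hW's hx.2 : (p x ∘L t x).IsInvertible).self_comp_inverse

theorem Morphism.exists_local_retraction (i : Morphism A B) (hp : ∀ x, Function.Injective (i x))
    (x₀ : X) : ∃ (W : Set X) (r : ∀ x, B.Fiber x →L[ℂ] A.Fiber x), IsOpen W ∧ x₀ ∈ W ∧
      IsHolOn W r ∧ ∀ x ∈ W, r x ∘L i x = ContinuousLinearMap.id ℂ _ := by
  obtain ⟨g, hg⟩ := LinearMap.exists_leftInverse_of_injective (i x₀ : A.Fiber x₀ →ₗ[ℂ] B.Fiber x₀)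
    (LinearMap.ker_eq_bot.2 (hp x₀))
  obtain ⟨t, W, hW, hxW, ht, htx⟩ := exists_local_extension x₀ (LinearMap.toContinuousLinearMap g)
  have hpt : IsHolOn W (fun x => t x ∘L i x) := ht.comp (i.isHol.mono (subset_univ _))
  have hi : (t x₀ ∘L i x₀).IsInvertible := by
    refine ⟨ContinuousLinearEquiv.refl ℂ _, ?_⟩
    ext m
    rw [htx]
    exact (LinearMap.congr_fun hg m).symm
  obtain ⟨W', hW's, hW', hxW'⟩ := mem_nhds_iff.1 (hpt.eventually_invertible hW hxW hi)
  refine ⟨W ∩ W', fun x => (t x ∘L i x).inverse ∘L t x, hW.inter hW', ⟨hxW, hxW'⟩, ?_, ?_⟩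
  · exact ((hpt.mono inter_subset_left).inverse fun x hx => hW's hx.2).comp
      (ht.mono inter_subset_left)
  · intro x hx
    rw [ContinuousLinearMap.comp_assoc]
    exact (hW's hx.2 : (t x ∘L i x).IsInvertible).inverse_comp_self

/-- Division by an injective bundle map. -/
theorem Morphism.exists_factor (i : Morphism A B) (hi : ∀ x, Function.Injective (i x)) {W : Set X}
    {d : ∀ x, C.Fiber x →L[ℂ] B.Fiber x} (hd : IsHolOn W d)
    (hr : ∀ x ∈ W, ∀ m, d x m ∈ range (i x)) :
    ∃ c : ∀ x, C.Fiber x →L[ℂ] A.Fiber x, IsHolOn W c ∧ ∀ x ∈ W, i x ∘L c x = d x := by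
  choose g hg using fun x => LinearMap.exists_leftInverse_of_injective (i x : A.Fiber x →ₗ[ℂ] B.Fiber x)
    (LinearMap.ker_eq_bot.2 (hi x))
  have hc : ∀ x ∈ W, i x ∘L (LinearMap.toContinuousLinearMap (g x) ∘L d x) = d x := by
    intro x hx
    ext m
    obtain ⟨a, ha⟩ := hr x hx m
    have := LinearMap.congr_fun (hg x) a
    simp only [LinearMap.comp_apply, ContinuousLinearMap.coe_coe, LinearMap.id_apply] at this
    simp [← ha, this]
  refine ⟨fun x => LinearMap.toContinuousLinearMap (g x) ∘L d x, ?_, hc⟩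
  refine IsHolOn.of_local fun x₀ hx₀ => ?_
  obtain ⟨W', r, hW', hxW', hr', hri⟩ := i.exists_local_retraction hi x₀
  refine ⟨W', hW', hxW', ?_⟩
  refine ((hr'.mono inter_subset_right).comp (hd.mono inter_subset_left)).congr fun x hx => ?_
  have h := congrArg (fun f => r x ∘L f) (hc x hx.1)
  rw [← ContinuousLinearMap.comp_assoc, hri x hx.2, ContinuousLinearMap.id_comp] at h
  exact h

/-- The holomorphic bundle maps `A → B` over `W`, as a subspace of all families of linear maps of
the fibres over `W`. (The family `ψ` is arbitrary outside `W`.) -/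
def homOn (A : HolBundle.{u, v} X) (B : HolBundle.{u, w} X) (W : Set X) :
    Submodule ℂ (∀ x : W, A.Fiber x →L[ℂ] B.Fiber x) where
  carrier := {φ | ∃ ψ : ∀ x, A.Fiber x →L[ℂ] B.Fiber x, IsHolOn W ψ ∧ ∀ x : W, φ x = ψ x}
  zero_mem' := ⟨fun _ => 0, isHolOn_zero W, fun _ => rfl⟩
  add_mem' := by
    rintro φ φ' ⟨ψ, h, e⟩ ⟨ψ', h', e'⟩
    exact ⟨_, h.add h', fun x => by rw [Pi.add_apply, e, e']⟩
  smul_mem' := by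
    rintro c φ ⟨ψ, h, e⟩
    exact ⟨_, h.smul c, fun x => by rw [Pi.smul_apply, e]⟩

/-- `ℋom(A, B)(W)`, the sections over `W` of the sheaf of holomorphic bundle maps `A → B`. -/
def Sec (A : HolBundle.{u, v} X) (B : HolBundle.{u, w} X) (W : Set X) : Type (max u v w) :=
  homOn A B W

instance (A : HolBundle.{u, v} X) (B : HolBundle.{u, w} X) (W : Set X) :
    AddCommGroup (Sec A B W) :=
  inferInstanceAs (AddCommGroup (homOn A B W))

instance (A : HolBundle.{u, v} X) (B : HolBundle.{u, w} X) (W : Set X) : Module ℂ (Sec A B W) :=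
  inferInstanceAs (Module ℂ (homOn A B W))

/-- The value at a point of `W`. -/
def Sec.val {A : HolBundle.{u, v} X} {B : HolBundle.{u, w} X} {W : Set X} (φ : Sec A B W)
    (x : X) (hx : x ∈ W) : A.Fiber x →L[ℂ] B.Fiber x :=
  φ.1 ⟨x, hx⟩

@[ext]
theorem Sec.ext {A : HolBundle.{u, v} X} {B : HolBundle.{u, w} X} {W : Set X} {φ ψ : Sec A B W}
    (h : ∀ x hx, φ.val x hx = ψ.val x hx) : φ = ψ :=
  Subtype.ext (funext fun x => h x.1 x.2)

/-- Restriction of sections. -/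
def Sec.res (A : HolBundle.{u, v} X) (B : HolBundle.{u, w} X) {W W' : Set X} (h : W' ⊆ W) :
    Sec A B W →ₗ[ℂ] Sec A B W' where
  toFun φ := ⟨fun x => φ.1 ⟨x, h x.2⟩, by
    obtain ⟨ψ, hψ, e⟩ := φ.2
    exact ⟨ψ, hψ.mono h, fun x => e _⟩⟩
  map_add' _ _ := rfl
  map_smul' _ _ := rfl

/-- A fibrewise linear map of sheaves of bundle maps `ℋom(A, B) → ℋom(A', B')`. -/
structure HomMap (A : HolBundle.{u, v} X) (B : HolBundle.{u, w} X)
    (A' : HolBundle.{u, w₁} X) (B' : HolBundle.{u, w₂} X) where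
  toFun : ∀ x, (A.Fiber x →L[ℂ] B.Fiber x) →ₗ[ℂ] (A'.Fiber x →L[ℂ] B'.Fiber x)
  isHol : ∀ (W : Set X) (φ : ∀ x, A.Fiber x →L[ℂ] B.Fiber x), IsHolOn W φ →
    IsHolOn W (fun x => toFun x (φ x))

/-- The map `ℋom(A, B) → ℋom(A, C)`, `φ ↦ f ∘ φ`. -/
def HomMap.postcomp (A : HolBundle.{u, v} X) (f : Morphism B C) : HomMap A B A C where
  toFun x :=
    { toFun := fun φ => f x ∘L φ
      map_add' := fun _ _ => ContinuousLinearMap.comp_add _ _ _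
      map_smul' := fun _ _ => ContinuousLinearMap.comp_smul _ _ _ }
  isHol W _ h := (f.isHol.mono (subset_univ W)).comp h

/-- The transposition `ℋom(A, B) → ℋom(B*, A*)`, `φ ↦ (s ↦ s ∘ φ)`. -/
def HomMap.transpose (A : HolBundle.{u, v} X) (B : HolBundle.{u, w} X) :
    HomMap A B B.dual A.dual where
  toFun x :=
    { toFun := fun φ => ContinuousLinearMap.precomp ℂ φ
      map_add' := fun _ _ => by ext; simp
      map_smul' := fun _ _ => by ext; simp }
  isHol _ _ h := h.transpose

/-- The map `ℋom(A, B)(W) → ℋom(A', B')(W)` on sections. -/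
def HomMap.onSections {A : HolBundle.{u, v} X} {B : HolBundle.{u, w} X}
    {A' : HolBundle.{u, w₁} X} {B' : HolBundle.{u, w₂} X} (T : HomMap A B A' B') (W : Set X) :
    Sec A B W →ₗ[ℂ] Sec A' B' W where
  toFun φ := ⟨fun x => T.toFun x (φ.1 x), by
    obtain ⟨ψ, hψ, e⟩ := φ.2
    exact ⟨_, T.isHol W ψ hψ, fun x => congrArg _ (e x)⟩⟩
  map_add' _ _ := by ext1 x _; exact map_add (T.toFun x) _ _
  map_smul' _ _ := by ext1 x _; exact map_smul (T.toFun x) _ _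

end Hom

/-- An open cover of `X` indexed by the points of `X`, the set with index `a` containing `a`. -/
structure PointedCover (X : Type u) [TopologicalSpace X] where
  nhd : X → Set X
  isOpen : ∀ a, IsOpen (nhd a)
  mem : ∀ a, a ∈ nhd a

/-- `U ≤ V` if `V` refines `U`, index by index. Every open cover is refined by a pointed one, and
any two pointed covers have a common refinement, so that colimits over all open covers can be
computed with pointed ones. -/
instance (X : Type u) [TopologicalSpace X] : Preorder (PointedCover X) where
  le U V := ∀ a, V.nhd a ⊆ U.nhd a
  le_refl _ _ := subset_rfl
  le_trans _ _ _ h h' a := (h' a).trans (h a)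

noncomputable section Cech

variable {X : Type u} [TopologicalSpace X] [ChartedSpace ℂ X]

/-- Čech 0-cochains of `ℋom(A, B)`. -/
abbrev C0 (A : HolBundle.{u, v} X) (B : HolBundle.{u, w} X) (U : PointedCover X) :=
  ∀ a : X, Sec A B (U.nhd a)

/-- Čech 1-cochains of `ℋom(A, B)`. -/
abbrev C1 (A : HolBundle.{u, v} X) (B : HolBundle.{u, w} X) (U : PointedCover X) :=
  ∀ a b : X, Sec A B (U.nhd a ∩ U.nhd b)

/-- The coboundary of a 0-cochain, `(dh)_{ab} = h_b - h_a`. -/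
def d0 (A : HolBundle.{u, v} X) (B : HolBundle.{u, w} X) (U : PointedCover X) :
    C0 A B U →ₗ[ℂ] C1 A B U where
  toFun h a b := Sec.res A B inter_subset_right (h b) - Sec.res A B inter_subset_left (h a)
  map_add' h h' := by
    funext a b; simp only [Pi.add_apply, map_add]; abel
  map_smul' c h := by
    funext a b; simp only [Pi.smul_apply, map_smul, smul_sub, RingHom.id_apply]

/-- The 1-cocycles: `c_{ad} = c_{ab} + c_{bd}` on triple intersections. -/
def Z1 (A : HolBundle.{u, v} X) (B : HolBundle.{u, w} X) (U : PointedCover X) :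
    Submodule ℂ (C1 A B U) where
  carrier := {c | ∀ (a b d x : X) (ha : x ∈ U.nhd a) (hb : x ∈ U.nhd b) (hd : x ∈ U.nhd d),
    (c a d).val x ⟨ha, hd⟩ = (c a b).val x ⟨ha, hb⟩ + (c b d).val x ⟨hb, hd⟩}
  zero_mem' _ _ _ _ _ _ _ := (add_zero _).symm
  add_mem' {c c'} h h' a b d x ha hb hd := by
    change (c a d).val x _ + (c' a d).val x _ =
      ((c a b).val x _ + (c' a b).val x _) + ((c b d).val x _ + (c' b d).val x _)
    rw [h a b d x ha hb hd, h' a b d x ha hb hd]; abel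
  smul_mem' r c h a b d x ha hb hd := by
    change r • (c a d).val x _ = r • (c a b).val x _ + r • (c b d).val x _
    rw [h a b d x ha hb hd, smul_add]

/-- Čech cohomology `H¹(U, ℋom(A, B))` of the cover `U`: 1-cocycles modulo 1-coboundaries. -/
def H1 (A : HolBundle.{u, v} X) (B : HolBundle.{u, w} X) (U : PointedCover X) :
    Type (max u v w) :=
  Z1 A B U ⧸ (LinearMap.range (d0 A B U)).comap (Z1 A B U).subtype

instance (A : HolBundle.{u, v} X) (B : HolBundle.{u, w} X) (U : PointedCover X) :
    AddCommGroup (H1 A B U) :=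
  inferInstanceAs (AddCommGroup (Z1 A B U ⧸ (LinearMap.range (d0 A B U)).comap (Z1 A B U).subtype))

instance (A : HolBundle.{u, v} X) (B : HolBundle.{u, w} X) (U : PointedCover X) :
    Module ℂ (H1 A B U) :=
  inferInstanceAs (Module ℂ (Z1 A B U ⧸ (LinearMap.range (d0 A B U)).comap (Z1 A B U).subtype))

/-- The class of a cocycle. -/
def H1.mk (A : HolBundle.{u, v} X) (B : HolBundle.{u, w} X) (U : PointedCover X) :
    Z1 A B U →ₗ[ℂ] H1 A B U :=
  Submodule.mkQ _

/-- Restriction of cocycles to a refinement. -/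
def Z1.res (A : HolBundle.{u, v} X) (B : HolBundle.{u, w} X) {U V : PointedCover X} (h : U ≤ V) :
    Z1 A B U →ₗ[ℂ] Z1 A B V where
  toFun c := ⟨fun a b => Sec.res A B (inter_subset_inter (h a) (h b)) (c.1 a b),
    fun a b d x ha hb hd => c.2 a b d x (h a ha) (h b hb) (h d hd)⟩
  map_add' _ _ := rfl
  map_smul' _ _ := rfl

/-- Restriction of classes to a refinement. -/
def H1.res (A : HolBundle.{u, v} X) (B : HolBundle.{u, w} X) {U V : PointedCover X} (h : U ≤ V) :
    H1 A B U →ₗ[ℂ] H1 A B V :=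
  Submodule.mapQ _ _ (Z1.res A B h) (by
    rintro c ⟨k, hk⟩
    exact ⟨fun a => Sec.res A B (h a) (k a), by
      funext a b
      have hk' : c.1 a b = d0 A B U k a b := (congrFun (congrFun hk a) b).symm
      change _ = Sec.res A B (inter_subset_inter (h a) (h b)) (c.1 a b)
      rw [hk']
      rfl⟩)

instance (X : Type u) [TopologicalSpace X] : DecidableEq (PointedCover X) := Classical.decEq _

/-- `Ext¹(A, B) = H¹(X, ℋom(A, B)) = H¹(X, A* ⊗ B)` for holomorphic vector bundles: Čech
cohomology, the colimit over all covers. -/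
def Ext1 (A : HolBundle.{u, v} X) (B : HolBundle.{u, w} X) : Type (max u v w) :=
  Module.DirectLimit (R := ℂ) (H1 A B) (fun _ _ h => H1.res A B h)

instance (A : HolBundle.{u, v} X) (B : HolBundle.{u, w} X) : AddCommGroup (Ext1 A B) :=
  inferInstanceAs (AddCommGroup
    (Module.DirectLimit (R := ℂ) (H1 A B) (fun _ _ h => H1.res A B h)))

instance (A : HolBundle.{u, v} X) (B : HolBundle.{u, w} X) : Module ℂ (Ext1 A B) :=
  inferInstanceAs (Module ℂ (Module.DirectLimit (R := ℂ) (H1 A B) (fun _ _ h => H1.res A B h)))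

/-- The class of a cocycle. -/
def Ext1.mk {A : HolBundle.{u, v} X} {B : HolBundle.{u, w} X} (U : PointedCover X) :
    Z1 A B U →ₗ[ℂ] Ext1 A B :=
  (Module.DirectLimit.of ℂ (PointedCover X) (H1 A B) (fun _ _ h => H1.res A B h) U) ∘ₗ
    H1.mk A B U

section Map

variable {A : HolBundle.{u, v} X} {B : HolBundle.{u, w} X}
    {A' : HolBundle.{u, w₁} X} {B' : HolBundle.{u, w₂} X} (T : HomMap A B A' B')

/-- The map on cocycles. -/
def Z1.map (U : PointedCover X) : Z1 A B U →ₗ[ℂ] Z1 A' B' U where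
  toFun c := ⟨fun a b => T.onSections _ (c.1 a b), fun a b d x ha hb hd => by
    exact (congrArg (T.toFun x) (c.2 a b d x ha hb hd)).trans (map_add (T.toFun x) _ _)⟩
  map_add' _ _ := by
    ext1; funext a b; exact map_add (T.onSections _) _ _
  map_smul' _ _ := by
    ext1; funext a b; exact map_smul (T.onSections _) _ _

/-- The map on the cohomology of a cover. -/
def H1.map (U : PointedCover X) : H1 A B U →ₗ[ℂ] H1 A' B' U :=
  Submodule.mapQ _ _ (Z1.map T U) (by
    rintro c ⟨k, hk⟩
    exact ⟨fun a => T.onSections _ (k a), by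
      funext a b
      have hk' : c.1 a b = d0 A B U k a b := (congrFun (congrFun hk a) b).symm
      change _ = T.onSections _ (c.1 a b)
      rw [hk']
      change _ = T.onSections _ (_ - _)
      rw [map_sub]
      rfl⟩)

/-- The map `Ext¹(A, B) → Ext¹(A', B')` induced by a map of sheaves `ℋom(A, B) → ℋom(A', B')`. -/
def Ext1.map : Ext1 A B →ₗ[ℂ] Ext1 A' B' :=
  Module.DirectLimit.map (H1.map T) (fun U V h => by
    refine LinearMap.ext fun c => ?_
    obtain ⟨c, rfl⟩ := Submodule.mkQ_surjective _ c
    rfl)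

theorem Ext1.map_mk (U : PointedCover X) (c : Z1 A B U) :
    Ext1.map T (Ext1.mk U c) = Ext1.mk U (Z1.map T U c) := by
  exact Module.DirectLimit.map_apply_of _ _ _

end Map

theorem Ext1.mk_res {A : HolBundle.{u, v} X} {B : HolBundle.{u, w} X} {U V : PointedCover X}
    (h : U ≤ V) (c : Z1 A B U) : Ext1.mk V (Z1.res A B h c) = Ext1.mk U c :=
  Module.DirectLimit.of_f (f := fun _ _ h => H1.res A B h) (hij := h) (x := H1.mk A B U c)

theorem Ext1.mk_eq_of_sub {A : HolBundle.{u, v} X} {B : HolBundle.{u, w} X} {U : PointedCover X}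
    {c c' : Z1 A B U} (k : C0 A B U) (h : d0 A B U k = c.1 - c'.1) :
    Ext1.mk U c = Ext1.mk U c' :=
  congrArg (Module.DirectLimit.of ℂ (PointedCover X) (H1 A B) (fun _ _ h => H1.res A B h) U)
    ((Submodule.Quotient.eq _).2 ⟨k, h⟩)

end Cech

noncomputable section Extensions

variable {X : Type u} [TopologicalSpace X] [ChartedSpace ℂ X]

/-- A short exact sequence `0 → A → E → B → 0` of holomorphic vector bundles. -/
structure Extension (A : HolBundle.{u, v} X) (E : HolBundle.{u, w} X) (B : HolBundle.{u, w₁} X) where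
  incl : Morphism A E
  proj : Morphism E B
  incl_injective : ∀ x, Function.Injective (incl x)
  proj_surjective : ∀ x, Function.Surjective (proj x)
  exact : ∀ x, range (incl x) = {e | proj x e = 0}

variable {A : HolBundle.{u, v} X} {E : HolBundle.{u, w} X} {B : HolBundle.{u, w₁} X}

/-- `δ` is the class in `Ext¹(B, A)` of the extension: it is represented by the cocycle
`c_{ab} = σ_b - σ_a : B → A` of the differences of some holomorphic splittings `σ_a : B → E` of
`E → B` over the members of a cover. -/
def Extension.IsClass (S : Extension A E B) (δ : Ext1 B A) : Prop :=
  ∃ (U : PointedCover X) (σ : C0 B E U) (c : Z1 B A U),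
    (∀ a x (hx : x ∈ U.nhd a), S.proj x ∘L (σ a).val x hx = ContinuousLinearMap.id ℂ _) ∧
    (∀ a b x (ha : x ∈ U.nhd a) (hb : x ∈ U.nhd b),
      S.incl x ∘L (c.1 a b).val x ⟨ha, hb⟩ = (σ b).val x hb - (σ a).val x ha) ∧
    Ext1.mk U c = δ

theorem Extension.exists_factor_sec (S : Extension A E B) {W : Set X} (d : Sec B E W)
    (hd : ∀ x hx, S.proj x ∘L d.val x hx = 0) :
    ∃ c : Sec B A W, ∀ x hx, S.incl x ∘L c.val x hx = d.val x hx := by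
  obtain ⟨ψ, hψ, e⟩ := d.2
  obtain ⟨c, hc, hcd⟩ := S.incl.exists_factor S.incl_injective hψ (fun x hx m => by
    rw [S.exact x, ← e ⟨x, hx⟩]
    exact DFunLike.congr_fun (hd x hx) m)
  exact ⟨⟨fun x => c x, c, hc, fun _ => rfl⟩, fun x hx => (hcd x hx).trans (e ⟨x, hx⟩).symm⟩

theorem Extension.incl_comp_injective (S : Extension A E B) {x : X}
    {f g : B.Fiber x →L[ℂ] A.Fiber x} (h : S.incl x ∘L f = S.incl x ∘L g) : f = g := by
  ext m
  exact S.incl_injective x (DFunLike.congr_fun h m)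

theorem Extension.exists_isClass (S : Extension A E B) : ∃ δ, S.IsClass δ := by
  choose W s hW hxW hs hps using S.proj.exists_local_section S.proj_surjective
  let U : PointedCover X := ⟨W, hW, hxW⟩
  let σ : C0 B E U := fun a => ⟨fun x => s a x, s a, hs a, fun _ => rfl⟩
  have hσ : ∀ a x (hx : x ∈ U.nhd a), S.proj x ∘L (σ a).val x hx = ContinuousLinearMap.id ℂ _ :=
    fun a x hx => hps a x hx
  have h : ∀ a b, ∃ c : Sec B A (U.nhd a ∩ U.nhd b), ∀ x hx,
      S.incl x ∘L c.val x hx = (σ b).val x hx.2 - (σ a).val x hx.1 := fun a b =>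
    S.exists_factor_sec (d0 B E U σ a b) fun x hx => by
      change S.proj x ∘L ((σ b).val x hx.2 - (σ a).val x hx.1) = 0
      rw [ContinuousLinearMap.comp_sub, hσ, hσ, sub_self]
  choose c hc using h
  refine ⟨_, U, σ, ⟨c, fun a b d x ha hb hd => ?_⟩, hσ, fun a b x ha hb => hc a b x ⟨ha, hb⟩, rfl⟩
  apply S.incl_comp_injective
  rw [ContinuousLinearMap.comp_add]
  refine (hc a d x ⟨ha, hd⟩).trans ?_
  refine Eq.trans ?_ (congrArg₂ (· + ·) (hc a b x ⟨ha, hb⟩) (hc b d x ⟨hb, hd⟩)).symm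
  exact (sub_add_sub_cancel' _ _ _).symm

theorem Extension.isClass_unique (S : Extension A E B) {δ δ' : Ext1 B A} (h : S.IsClass δ)
    (h' : S.IsClass δ') : δ = δ' := by
  obtain ⟨U, σ, c, hσ, hc, rfl⟩ := h
  obtain ⟨U', σ', c', hσ', hc', rfl⟩ := h'
  let V : PointedCover X := ⟨fun a => U.nhd a ∩ U'.nhd a, fun a => (U.isOpen a).inter (U'.isOpen a),
    fun a => ⟨U.mem a, U'.mem a⟩⟩
  have hU : U ≤ V := fun a => inter_subset_left
  have hU' : U' ≤ V := fun a => inter_subset_right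
  have h : ∀ a, ∃ k : Sec B A (V.nhd a), ∀ x hx,
      S.incl x ∘L k.val x hx = (σ a).val x hx.1 - (σ' a).val x hx.2 := fun a =>
    S.exists_factor_sec (Sec.res B E (hU a) (σ a) - Sec.res B E (hU' a) (σ' a)) fun x hx => by
      change S.proj x ∘L ((σ a).val x hx.1 - (σ' a).val x hx.2) = 0
      rw [ContinuousLinearMap.comp_sub, hσ, hσ', sub_self]
  choose k hk using h
  rw [← Ext1.mk_res hU, ← Ext1.mk_res hU']
  refine Ext1.mk_eq_of_sub k ?_
  funext a b
  ext1 x hx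
  apply S.incl_comp_injective
  change S.incl x ∘L ((k b).val x hx.2 - (k a).val x hx.1) =
    S.incl x ∘L ((c.1 a b).val x ⟨hx.1.1, hx.2.1⟩ - (c'.1 a b).val x ⟨hx.1.2, hx.2.2⟩)
  rw [ContinuousLinearMap.comp_sub, ContinuousLinearMap.comp_sub, hk, hk,
    hc a b x hx.1.1 hx.2.1, hc' a b x hx.1.2 hx.2.2]
  abel

/-- The class of an extension `0 → A → E → B → 0` in `Ext¹(B, A)`; it exists and does not depend on
the local splittings. -/
def Extension.cls (S : Extension A E B) : Ext1 B A := S.exists_isClass.choose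

theorem Extension.isClass_iff (S : Extension A E B) (δ : Ext1 B A) : S.IsClass δ ↔ δ = S.cls :=
  ⟨fun h => S.isClass_unique h S.exists_isClass.choose_spec,
    fun h => h ▸ S.exists_isClass.choose_spec⟩

end Extensions

noncomputable section Symplectic

variable {X : Type u} [TopologicalSpace X] [ChartedSpace ℂ X]

/-- A holomorphic symplectic form `Ω` on `A`, given by `Ω^♭ : A → A*`, `v ↦ Ω(v, ·)`. -/
structure SymplecticForm (A : HolBundle.{u, v} X) where
  flat : Morphism A A.dual
  alternating : ∀ x v, flat x v v = 0
  nondegenerate : ∀ x v, (∀ w, flat x v w = 0) → v = 0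

variable {A : HolBundle.{u, v} X} {B : HolBundle.{u, w} X} {C : HolBundle.{u, w₁} X}

theorem SymplecticForm.flat_isInvertible (Ω : SymplecticForm A) (x : X) :
    (Ω.flat x).IsInvertible := by
  apply isInvertible_of_bijective
  have hinj : Function.Injective (Ω.flat x) := by
    rw [injective_iff_map_eq_zero]
    exact fun v hv => Ω.nondegenerate x v fun w => DFunLike.congr_fun hv w
  refine ⟨hinj, ?_⟩
  have hd : Module.finrank ℂ (A.Fiber x) = Module.finrank ℂ (A.dual.Fiber x) := by
    rw [← Subspace.dual_finrank_eq (K := ℂ) (V := A.Fiber x)]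
    exact (LinearMap.toContinuousLinearMap (𝕜 := ℂ) (E := A.Fiber x) (F' := ℂ)).finrank_eq
  exact (LinearMap.injective_iff_surjective_of_finrank_eq_finrank hd
    (f := (Ω.flat x : A.Fiber x →ₗ[ℂ] A.dual.Fiber x))).1 hinj

/-- The inverse `(Ω^♭)⁻¹ : A* → A` of `Ω^♭`. -/
def SymplecticForm.sharp (Ω : SymplecticForm A) : Morphism A.dual A where
  toFun x := (Ω.flat x).inverse
  isHol := Ω.flat.isHol.inverse fun x _ => Ω.flat_isInvertible x

/-- The `θ`-dual `δ^θ ∈ Ext¹(B*, A)` of a class `δ ∈ Ext¹(A, B)`, obtained through the map of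
sheaves `ℋom(A, B) → ℋom(B*, A*) → ℋom(B*, A)`, `c ↦ (θ^♭)⁻¹ ∘ cᵗ`; in terms of tensor products it
is `(θ^♭)⁻¹ ⊗ id : A* ⊗ B → A ⊗ B`. -/
def SymplecticForm.dualClass (θ : SymplecticForm A) : Ext1 A B →ₗ[ℂ] Ext1 B.dual A :=
  Ext1.map (HomMap.postcomp B.dual θ.sharp) ∘ₗ Ext1.map (HomMap.transpose A B)

/-- The fibrewise characterisation of the `θ`-dual: `θ(c^θ(s), u) = ⟨c(u), s⟩`. -/
theorem SymplecticForm.sharp_transpose (θ : SymplecticForm A) (x : X)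
    (c : A.Fiber x →L[ℂ] B.Fiber x) (s : B.dual.Fiber x) (u : A.Fiber x) :
    θ.flat x (θ.sharp x ((HomMap.transpose A B).toFun x c s)) u = s (c u) := by
  change θ.flat x ((θ.flat x).inverse _) u = _
  rw [(θ.flat_isInvertible x).self_apply_inverse]
  rfl

end Symplectic

/-- `L` is a `K^{-1/2}`: a holomorphic line bundle with `L ⊗ L ≅ K⁻¹ = TX`. The isomorphism is
given by the bilinear map `q : L × L → TX`, which is non-zero on non-zero vectors. -/
def IsInvSqrtCanonical {X : Type u} [TopologicalSpace X] [ChartedSpace ℂ X] [IsManifold 𝓘(ℂ) ω X]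
    (L : HolBundle.{u, v} X) : Prop :=
  L.rank = 1 ∧ ∃ q : Morphism L (L.hom (tangent X)), ∀ x (l : L.Fiber x), l ≠ 0 → q x l l ≠ 0

end HolBundle

/-!
Local splittings of both extensions identify `V` with `L ⊕ U ⊕ L⁻¹`. Because `L⁻¹` has rank one, a
form on `V` with the required properties has only one free component there, the pairing between
`U` and `L⁻¹`, which is the same thing as a map `L⁻¹ → U`; conversely every such map occurs, and the
resulting form is automatically symplectic. Under a change of splittings by cocycles `c : U → L` and
`e : L⁻¹ → E`, this map changes by the difference of the image of `e` in `Hom(L⁻¹, U)` and the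
`θ`-dual of `c`. Hence the local forms can be chosen to agree on overlaps exactly when this
difference of cocycles is a coboundary.
-/

namespace HolBundle

noncomputable section Sections

variable {X : Type u} [TopologicalSpace X] [ChartedSpace ℂ X]
  {A : HolBundle.{u, v} X} {B : HolBundle.{u, w} X} {C : HolBundle.{u, w₁} X} {W : Set X}

/-- The restriction of a bundle morphism to `W`, as a section of the sheaf `ℋom(A, B)`. -/
def Morphism.toSec (f : Morphism A B) (W : Set X) : Sec A B W :=
  ⟨fun x => f x, f, f.isHol.mono (subset_univ W), fun _ => rfl⟩

/-- The fibrewise composition `ℋom(B, C)(W) × ℋom(A, B)(W) → ℋom(A, C)(W)`. -/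
def Sec.comp (g : Sec B C W) (f : Sec A B W) : Sec A C W :=
  ⟨fun x => g.1 x ∘L f.1 x, by
    obtain ⟨φ, hφ, hfφ⟩ := f.2
    obtain ⟨ψ, hψ, hgψ⟩ := g.2
    exact ⟨fun x => ψ x ∘L φ x, hψ.comp hφ, fun x =>
      congrArg₂ ContinuousLinearMap.comp (hgψ x) (hfφ x)⟩⟩

/-- The fibrewise transposition `ℋom(A, B)(W) → ℋom(B*, A*)(W)`. -/
def Sec.transpose (f : Sec A B W) : Sec B.dual A.dual W :=
  (HomMap.transpose A B).onSections W f

/-- The identity of `A`, as a section of `ℋom(A, A)` over `W`. -/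
def Sec.id (A : HolBundle.{u, v} X) (W : Set X) : Sec A A W :=
  ⟨fun _ => ContinuousLinearMap.id ℂ _, _, isHolOn_id W, fun _ => rfl⟩

/-- The canonical morphism `A → A**`, evaluation of functionals. -/
def evalDual (A : HolBundle.{u, v} X) : Morphism A A.dual.dual where
  toFun x := LinearMap.toContinuousLinearMap
    (LinearMap.toContinuousLinearMap.toLinearMap ∘ₗ
      (ContinuousLinearMap.coeLM ℂ : (A.Fiber x →L[ℂ] ℂ) →ₗ[ℂ] A.Fiber x →ₗ[ℂ] ℂ).flip)
  isHol := by
    refine IsHolOn.of_coord fun x₀ _ =>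
      ⟨fun _ => (ContinuousLinearMap.id ℂ (A.Model →L[ℂ] ℂ)).flip, contMDiffWithinAt_const,
        fun x _ hA hA' => ?_⟩
    ext m s
    obtain ⟨t, rfl⟩ := (A.dual.chart x₀ (A.dual.dual_triv hA')).surjective s
    simp only [ContinuousLinearMap.comp_apply, ContinuousLinearEquiv.coe_coe]
    rw [dual_chart_apply A.dual hA', ContinuousLinearMap.comp_apply, ContinuousLinearEquiv.coe_coe,
      ContinuousLinearEquiv.symm_apply_apply, dual_chart_apply]
    rfl

theorem finrank_fiber (A : HolBundle.{u, v} X) (x : X) :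
    Module.finrank ℂ (A.Fiber x) = A.rank :=
  (A.chart x (mem_of_mem_nhds (A.triv_mem x))).toLinearEquiv.finrank_eq

theorem rank_dual (A : HolBundle.{u, v} X) : A.dual.rank = A.rank :=
  (LinearMap.toContinuousLinearMap (𝕜 := ℂ) (E := A.Model) (F' := ℂ)).finrank_eq.symm.trans
    Subspace.dual_finrank_eq

end Sections

section Cech

variable {X : Type u} [TopologicalSpace X]

instance : IsDirectedOrder (PointedCover X) where
  directed P Q :=
    ⟨⟨fun a => P.nhd a ∩ Q.nhd a, fun a => (P.isOpen a).inter (Q.isOpen a),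
      fun a => ⟨P.mem a, Q.mem a⟩⟩, fun _ => inter_subset_left, fun _ => inter_subset_right⟩

variable [ChartedSpace ℂ X] {A : HolBundle.{u, v} X} {B : HolBundle.{u, w} X}

instance : DirectedSystem (H1 A B) (fun _ _ h => H1.res A B h) where
  map_self _ c := by
    obtain ⟨c, rfl⟩ := Submodule.mkQ_surjective _ c
    rfl
  map_map _ _ _ _ _ c := by
    obtain ⟨c, rfl⟩ := Submodule.mkQ_surjective _ c
    rfl

variable {P : PointedCover X}

theorem d0_eq_iff {k : C0 A B P} {c : C1 A B P} :
    d0 A B P k = c ↔ ∀ a b x (ha : x ∈ P.nhd a) (hb : x ∈ P.nhd b),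
      (k b).val x hb - (k a).val x ha = (c a b).val x ⟨ha, hb⟩ := by
  constructor
  · rintro rfl a b x ha hb
    rfl
  · intro h
    funext a b
    ext1 x hx
    exact h a b x hx.1 hx.2

theorem exists_morphism_of_d0_eq_zero {φ : C0 A B P} (h : d0 A B P φ = 0) :
    ∃ f : Morphism A B, ∀ a x (hx : x ∈ P.nhd a), f x = (φ a).val x hx := by
  have agree a b x (ha : x ∈ P.nhd a) (hb : x ∈ P.nhd b) : (φ b).val x hb = (φ a).val x ha :=
    sub_eq_zero.1 (d0_eq_iff.1 h a b x ha hb)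
  refine ⟨⟨fun x => (φ x).val x (P.mem x), IsHolOn.of_local fun a _ => ?_⟩,
    fun a x hx => agree a x x hx (P.mem x)⟩
  obtain ⟨ψ, hψ, hφψ⟩ := (φ a).2
  exact ⟨P.nhd a, P.isOpen a, P.mem a, (hψ.mono inter_subset_right).congr fun x hx =>
    (agree a x x hx.2 (P.mem x)).trans (hφψ ⟨x, hx.2⟩)⟩

theorem Ext1.mk_eq_mk_iff {c c' : Z1 A B P} :
    Ext1.mk P c = Ext1.mk P c' ↔ ∃ (Q : PointedCover X) (h : P ≤ Q) (k : C0 A B Q),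
      d0 A B Q k = (Z1.res A B h c).1 - (Z1.res A B h c').1 := by
  constructor
  · intro h
    have hsub : Ext1.mk P (c - c') = 0 := by rw [map_sub, h, sub_self]
    obtain ⟨Q, hPQ, hQ⟩ := Module.DirectLimit.of.zero_exact hsub
    obtain ⟨k, hk⟩ := (Submodule.Quotient.mk_eq_zero _ (x := Z1.res A B hPQ (c - c'))).1 hQ
    exact ⟨Q, hPQ, k, hk⟩
  · rintro ⟨Q, hPQ, k, hk⟩
    rw [← Ext1.mk_res hPQ c, ← Ext1.mk_res hPQ c']
    exact Ext1.mk_eq_of_sub k hk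

end Cech

section Extensions

variable {X : Type u} [TopologicalSpace X] [ChartedSpace ℂ X]
  {A : HolBundle.{u, v} X} {E : HolBundle.{u, w} X} {B : HolBundle.{u, w₁} X}

namespace Extension

/-- The sections `σ a` are splittings of the extension over the members of the cover, and `c` is
the cocycle `σ b - σ a` of their differences. -/
structure IsSplitting (S : Extension A E B) {P : PointedCover X} (σ : C0 B E P) (c : Z1 B A P) :
    Prop where
  proj_apply : ∀ a x (hx : x ∈ P.nhd a) b, S.proj x ((σ a).val x hx b) = b
  incl_apply : ∀ a b x (ha : x ∈ P.nhd a) (hb : x ∈ P.nhd b) m,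
    S.incl x ((c.1 a b).val x ⟨ha, hb⟩ m) = (σ b).val x hb m - (σ a).val x ha m

variable (S : Extension A E B)

theorem IsSplitting.res {S : Extension A E B} {P Q : PointedCover X} {σ : C0 B E P} {c : Z1 B A P}
    (h : S.IsSplitting σ c) (hPQ : P ≤ Q) :
    S.IsSplitting (fun a => Sec.res B E (hPQ a) (σ a)) (Z1.res B A hPQ c) where
  proj_apply a x hx := h.proj_apply a x (hPQ a hx)
  incl_apply a b x ha hb := h.incl_apply a b x (hPQ a ha) (hPQ b hb)

theorem exists_isSplitting : ∃ (P : PointedCover X) (σ : C0 B E P) (c : Z1 B A P),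
    S.IsSplitting σ c ∧ Ext1.mk P c = S.cls := by
  obtain ⟨P, σ, c, hproj, hincl, hc⟩ := (S.isClass_iff _).2 rfl
  exact ⟨P, σ, c, ⟨fun a x hx => DFunLike.congr_fun (hproj a x hx),
    fun a b x ha hb => DFunLike.congr_fun (hincl a b x ha hb)⟩, hc⟩

theorem proj_incl (x : X) (a : A.Fiber x) : S.proj x (S.incl x a) = 0 :=
  (S.exact x).subset ⟨a, rfl⟩

theorem exists_incl_eq {x : X} {e : E.Fiber x} (he : S.proj x e = 0) : ∃ a, S.incl x a = e :=
  (S.exact x).superset he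

theorem exists_eq_incl_add {x : X} {σ : B.Fiber x →L[ℂ] E.Fiber x}
    (hσ : ∀ b, S.proj x (σ b) = b) (e : E.Fiber x) : ∃ a b, e = S.incl x a + σ b := by
  obtain ⟨a, ha⟩ := S.exists_incl_eq (e := e - σ (S.proj x e)) (by rw [map_sub, hσ, sub_self])
  exact ⟨a, S.proj x e, by rw [ha, sub_add_cancel]⟩

theorem exists_retraction {W : Set X} {σ : Sec B E W}
    (hσ : ∀ x hx b, S.proj x (σ.val x hx b) = b) :
    ∃ r : Sec E A W, ∀ x hx, (∀ a, r.val x hx (S.incl x a) = a) ∧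
      ∀ b, r.val x hx (σ.val x hx b) = 0 := by
  obtain ⟨d, hd, hdσ⟩ := (Sec.id E W - σ.comp (S.proj.toSec W)).2
  have apply_d x (hx : x ∈ W) e : d x e = e - σ.val x hx (S.proj x e) :=
    (DFunLike.congr_fun (hdσ ⟨x, hx⟩) e).symm
  obtain ⟨r, hr, hrd⟩ := S.incl.exists_factor S.incl_injective hd fun x hx e => by
    rw [S.exact x, mem_ofPred_eq, apply_d x hx, map_sub, hσ, sub_self]
  have incl_r x (hx : x ∈ W) e : S.incl x (r x e) = e - σ.val x hx (S.proj x e) :=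
    (DFunLike.congr_fun (hrd x hx) e).trans (apply_d x hx e)
  refine ⟨⟨fun x => r x, r, hr, fun _ => rfl⟩, fun x hx => ⟨fun a => ?_, fun b => ?_⟩⟩
  · exact S.incl_injective x ((incl_r x hx _).trans (by rw [S.proj_incl, map_zero, sub_zero]))
  · exact S.incl_injective x ((incl_r x hx _).trans (by rw [hσ, sub_self, map_zero]))

end Extension

end Extensions

theorem eq_zero_of_isAlt_of_finrank_eq_one {K M N : Type*} [Field K] [AddCommGroup M] [Module K M]
    [AddCommGroup N] [Module K N] {β : M →ₗ[K] M →ₗ[K] N} (hβ : β.IsAlt)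
    (hM : Module.finrank K M = 1) : β = 0 := by
  obtain ⟨m, -, hm⟩ := finrank_eq_one_iff'.1 hM
  ext v w
  obtain ⟨r, rfl⟩ := hm v
  obtain ⟨s, rfl⟩ := hm w
  simp [hβ m]

noncomputable section Symplectic

variable {X : Type u} [TopologicalSpace X] [ChartedSpace ℂ X]
  {L : HolBundle.{u, v} X} {U : HolBundle.{u, w} X} {E : HolBundle.{u, w₁} X}
  {V : HolBundle.{u, w₂} X}

namespace SymplecticForm

/-- The `θ`-dual `c ↦ (θ^♭)⁻¹ ∘ cᵗ` on cocycles; it represents `dualClass`. -/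
def dualCocycle (θ : SymplecticForm U) {P : PointedCover X} : Z1 U L P →ₗ[ℂ] Z1 L.dual U P :=
  Z1.map (HomMap.postcomp L.dual θ.sharp) P ∘ₗ Z1.map (HomMap.transpose U L) P

theorem dualClass_mk (θ : SymplecticForm U) {P : PointedCover X} (c : Z1 U L P) :
    θ.dualClass (Ext1.mk P c) = Ext1.mk P (θ.dualCocycle c) := by
  rw [dualClass, LinearMap.comp_apply, Ext1.map_mk, Ext1.map_mk]
  rfl

/-- The pullback of the symplectic form `θ ⊕ ⟨ , ⟩` on `U ⊕ (L ⊕ L*)` along `(μ, ρ, q)`. -/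
def hyperbolicPullback (θ : SymplecticForm U) {W : Set X} (μ : Sec V U W) (ρ : Sec V L W)
    (q : Sec V L.dual W) : Sec V V.dual W :=
  μ.transpose.comp ((θ.flat.toSec W).comp μ) + q.transpose.comp ((L.evalDual.toSec W).comp ρ) -
    ρ.transpose.comp q

theorem hyperbolicPullback_apply (θ : SymplecticForm U) {W : Set X} (μ : Sec V U W)
    (ρ : Sec V L W) (q : Sec V L.dual W) {x : X} (hx : x ∈ W) (v v' : V.Fiber x) :
    (θ.hyperbolicPullback μ ρ q).val x hx v v' =
      θ.flat x (μ.val x hx v) (μ.val x hx v') + q.val x hx v' (ρ.val x hx v) -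
        q.val x hx v (ρ.val x hx v') :=
  rfl

/-- The component of a form `Ω` on `V` that pairs the images of `τ : B → V` and `α : U → V`, written
as a map `B → U` by means of `θ`. -/
def mixedTerm {B : HolBundle.{u, v} X} (θ : SymplecticForm U) {W : Set X} (Ω : Sec V V.dual W)
    (α : Sec U V W) (τ : Sec B V W) : Sec B U W :=
  (θ.sharp.toSec W).comp (α.transpose.comp (Ω.comp τ))

theorem flat_mixedTerm {B : HolBundle.{u, v} X} (θ : SymplecticForm U) {W : Set X}
    (Ω : Sec V V.dual W) (α : Sec U V W) (τ : Sec B V W) {x : X} (hx : x ∈ W) (b : B.Fiber x)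
    (u : U.Fiber x) :
    θ.flat x ((θ.mixedTerm Ω α τ).val x hx b) u = Ω.val x hx (τ.val x hx b) (α.val x hx u) :=
  DFunLike.congr_fun ((θ.flat_isInvertible x).self_apply_inverse
    ((α.transpose.comp (Ω.comp τ)).val x hx b)) u

end SymplecticForm

/-- The bilinear form `Ω` on the fibre of `V` at `x`, given as `v ↦ Ω(v, ·)`, is alternating,
induces `θ` on `E / L ≅ U`, and induces the given identification `V / E ≅ L⁻¹`. Nondegeneracy and
`L^⊥ = E` are consequences. -/
structure IsCompatible (θ : SymplecticForm U) (S : Extension L E U) (T : Extension E V L.dual)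
    (x : X) (Ω : V.Fiber x →L[ℂ] V.dual.Fiber x) : Prop where
  alternating : ∀ v, Ω v v = 0
  apply_incl_incl : ∀ e e', Ω (T.incl x e) (T.incl x e') = θ.flat x (S.proj x e) (S.proj x e')
  apply_incl_incl_left : ∀ l v, Ω (T.incl x (S.incl x l)) v = T.proj x v l

namespace IsCompatible

variable {θ : SymplecticForm U} {S : Extension L E U} {T : Extension E V L.dual} {x : X}
  {Ω Ω' : V.Fiber x →L[ℂ] V.dual.Fiber x}

theorem neg (h : IsCompatible θ S T x Ω) (v v' : V.Fiber x) : -Ω v v' = Ω v' v := by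
  have alt_add := h.alternating (v + v')
  simp only [map_add, _root_.add_apply, h.alternating, zero_add, add_zero] at alt_add
  linear_combination -alt_add

theorem orthogonal (h : IsCompatible θ S T x Ω) :
    {v | ∀ l, Ω (T.incl x (S.incl x l)) v = 0} = range (T.incl x) := by
  rw [T.exact x]
  ext v
  simp only [mem_ofPred_eq, h.apply_incl_incl_left]
  exact ⟨fun hv => ContinuousLinearMap.ext hv, fun hv l => by rw [hv]; rfl⟩

theorem nondegenerate (h : IsCompatible θ S T x Ω) {v : V.Fiber x} (hv : ∀ v', Ω v v' = 0) :
    v = 0 := by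
  obtain ⟨e, rfl⟩ : v ∈ range (T.incl x) := by
    rw [← h.orthogonal]
    intro l
    rw [← h.neg, hv, neg_zero]
  have proj_e : S.proj x e = 0 := θ.nondegenerate x _ fun u => by
    obtain ⟨e', rfl⟩ := S.proj_surjective x u
    rw [← h.apply_incl_incl, hv]
  obtain ⟨l, rfl⟩ := S.exists_incl_eq proj_e
  have l_eq_zero : l = 0 := (Module.forall_dual_apply_eq_zero_iff ℂ l).1 fun s => by
    obtain ⟨v', hv'⟩ := T.proj_surjective x (LinearMap.toContinuousLinearMap s)
    have apply_l := h.apply_incl_incl_left l v'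
    rw [hv, hv'] at apply_l
    exact apply_l.symm
  rw [l_eq_zero, map_zero, map_zero]

theorem apply_sub_apply_of_splitting (h : IsCompatible θ S T x Ω)
    {σ σ' : U.Fiber x →L[ℂ] E.Fiber x} {τ τ' : L.dual.Fiber x →L[ℂ] V.Fiber x}
    {c : U.Fiber x →L[ℂ] L.Fiber x} {e : L.dual.Fiber x →L[ℂ] E.Fiber x}
    (hσ' : ∀ u, S.proj x (σ' u) = u) (hτ : ∀ s, T.proj x (τ s) = s)
    (hc : ∀ u, S.incl x (c u) = σ' u - σ u) (he : ∀ s, T.incl x (e s) = τ' s - τ s)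
    (s : L.dual.Fiber x) (u : U.Fiber x) :
    Ω (τ' s) (T.incl x (σ' u)) - Ω (τ s) (T.incl x (σ u)) =
      θ.flat x (S.proj x (e s)) u - s (c u) := by
  have change_τ : Ω (τ' s) (T.incl x (σ' u)) - Ω (τ s) (T.incl x (σ' u)) =
      θ.flat x (S.proj x (e s)) u := by
    rw [← _root_.sub_apply, ← map_sub, ← he, h.apply_incl_incl, hσ']
  have change_σ : Ω (τ s) (T.incl x (σ' u)) - Ω (τ s) (T.incl x (σ u)) = -s (c u) := by
    rw [← map_sub, ← map_sub, ← hc, ← h.neg, h.apply_incl_incl_left, hτ]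
  linear_combination change_τ + change_σ

theorem apply_apply_eq_zero (hL : L.rank = 1) (h : IsCompatible θ S T x Ω)
    (τ : L.dual.Fiber x →L[ℂ] V.Fiber x) (s s' : L.dual.Fiber x) : Ω (τ s) (τ s') = 0 := by
  let β : L.dual.Fiber x →ₗ[ℂ] L.dual.Fiber x →ₗ[ℂ] ℂ :=
    (ContinuousLinearMap.toLinearMap₁₂ Ω).compl₁₂ τ τ
  have β_eq_zero : β = 0 := eq_zero_of_isAlt_of_finrank_eq_one (fun t => h.alternating (τ t))
    (by rw [finrank_fiber, rank_dual, hL])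
  exact LinearMap.congr_fun₂ β_eq_zero s s'

theorem ext (hL : L.rank = 1) (h : IsCompatible θ S T x Ω) (h' : IsCompatible θ S T x Ω')
    {σ : U.Fiber x →L[ℂ] E.Fiber x} {τ : L.dual.Fiber x →L[ℂ] V.Fiber x}
    (hσ : ∀ u, S.proj x (σ u) = u) (hτ : ∀ s, T.proj x (τ s) = s)
    (hΩ : ∀ s u, Ω (τ s) (T.incl x (σ u)) = Ω' (τ s) (T.incl x (σ u))) : Ω = Ω' := by
  have eq_on_τ_incl s e : Ω (τ s) (T.incl x e) = Ω' (τ s) (T.incl x e) := by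
    obtain ⟨l, u, rfl⟩ := S.exists_eq_incl_add hσ e
    rw [map_add, map_add, map_add, hΩ, ← h.neg (T.incl x (S.incl x l)),
      ← h'.neg (T.incl x (S.incl x l)), h.apply_incl_incl_left, h'.apply_incl_incl_left]
  ext v v'
  obtain ⟨e, s, rfl⟩ := T.exists_eq_incl_add hτ v
  obtain ⟨e', s', rfl⟩ := T.exists_eq_incl_add hτ v'
  simp only [map_add, _root_.add_apply]
  rw [h.apply_incl_incl, h'.apply_incl_incl, h.apply_apply_eq_zero hL, h'.apply_apply_eq_zero hL,
    eq_on_τ_incl, ← h.neg (τ s') (T.incl x e), ← h'.neg (τ s') (T.incl x e), eq_on_τ_incl]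

end IsCompatible

variable {θ : SymplecticForm U} {S : Extension L E U} {T : Extension E V L.dual}

theorem forall_isCompatible_iff {Ω : SymplecticForm V} :
    (∀ x, IsCompatible θ S T x (Ω.flat x)) ↔
      (∀ x, {v | ∀ l, Ω.flat x (T.incl x (S.incl x l)) v = 0} = range (T.incl x)) ∧
      (∀ x e e', Ω.flat x (T.incl x e) (T.incl x e') = θ.flat x (S.proj x e) (S.proj x e')) ∧
      (∀ x l v, Ω.flat x (T.incl x (S.incl x l)) v = T.proj x v l) :=
  ⟨fun h => ⟨fun x => (h x).orthogonal, fun x => (h x).apply_incl_incl,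
    fun x => (h x).apply_incl_incl_left⟩,
    fun h x => ⟨Ω.alternating x, h.2.1 x, h.2.2 x⟩⟩

theorem isCompatible_hyperbolicPullback {W : Set X} {μ : Sec V U W} {ρ : Sec V L W} {x : X}
    (hx : x ∈ W) (hμ : ∀ e, μ.val x hx (T.incl x e) = S.proj x e)
    (hρ : ∀ l, ρ.val x hx (T.incl x (S.incl x l)) = l) :
    IsCompatible θ S T x ((θ.hyperbolicPullback μ ρ (T.proj.toSec W)).val x hx) where
  alternating v := by
    rw [θ.hyperbolicPullback_apply, θ.alternating, zero_add, sub_self]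
  apply_incl_incl e e' := by
    have proj_zero e l : (T.proj.toSec W).val x hx (T.incl x e) l = 0 :=
      DFunLike.congr_fun (T.proj_incl x e) l
    rw [θ.hyperbolicPullback_apply, hμ, hμ, proj_zero, proj_zero, add_zero, sub_zero]
  apply_incl_incl_left l v := by
    have proj_zero l' : (T.proj.toSec W).val x hx (T.incl x (S.incl x l)) l' = 0 :=
      DFunLike.congr_fun (T.proj_incl x _) l'
    rw [θ.hyperbolicPullback_apply, hμ, S.proj_incl, map_zero, hρ, proj_zero, sub_zero]
    exact zero_add _

theorem exists_isCompatible {W : Set X} {σ : Sec U E W} {τ : Sec L.dual V W}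
    (hσ : ∀ x hx u, S.proj x (σ.val x hx u) = u) (hτ : ∀ x hx s, T.proj x (τ.val x hx s) = s)
    (κ : Sec L.dual U W) :
    ∃ Ω : Sec V V.dual W, ∀ x hx, IsCompatible θ S T x (Ω.val x hx) ∧
      ∀ s u, Ω.val x hx (τ.val x hx s) (T.incl x (σ.val x hx u)) =
        θ.flat x (κ.val x hx s) u := by
  obtain ⟨r, hr⟩ := T.exists_retraction hτ
  obtain ⟨l, hl⟩ := S.exists_retraction hσ
  let μ : Sec V U W := (S.proj.toSec W).comp r + κ.comp (T.proj.toSec W)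
  have μ_apply x hx v :
      μ.val x hx v = S.proj x (r.val x hx v) + κ.val x hx (T.proj x v) := rfl
  have μ_incl x hx e : μ.val x hx (T.incl x e) = S.proj x e := by
    rw [μ_apply, (hr x hx).1, T.proj_incl, map_zero, add_zero]
  have μ_τ x hx s : μ.val x hx (τ.val x hx s) = κ.val x hx s := by
    rw [μ_apply, (hr x hx).2, hτ, map_zero, zero_add]
  have ρ_incl x hx e : (l.comp r).val x hx (T.incl x e) = l.val x hx e :=
    congrArg (l.val x hx) ((hr x hx).1 e)
  refine ⟨θ.hyperbolicPullback μ (l.comp r) (T.proj.toSec W), fun x hx =>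
    ⟨isCompatible_hyperbolicPullback hx (μ_incl x hx) fun m => by rw [ρ_incl, (hl x hx).1],
      fun s u => ?_⟩⟩
  have proj_zero m : (T.proj.toSec W).val x hx (T.incl x (σ.val x hx u)) m = 0 :=
    DFunLike.congr_fun (T.proj_incl x _) m
  rw [θ.hyperbolicPullback_apply, μ_τ, μ_incl, hσ, proj_zero, ρ_incl, (hl x hx).2, map_zero,
    add_zero, sub_zero]

section Gluing

variable {P : PointedCover X} {σ : C0 U E P} {c : Z1 U L P} {τ : C0 L.dual V P}
  {e : Z1 L.dual E P}

theorem d0_eq_sub_dualCocycle_iff {k : C0 L.dual U P} :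
    d0 L.dual U P k =
        (Z1.map (HomMap.postcomp L.dual S.proj) P e).1 - (θ.dualCocycle c).1 ↔
      ∀ a b x (ha : x ∈ P.nhd a) (hb : x ∈ P.nhd b) s u,
        θ.flat x ((k b).val x hb s) u - θ.flat x ((k a).val x ha s) u =
          θ.flat x (S.proj x ((e.1 a b).val x ⟨ha, hb⟩ s)) u - s ((c.1 a b).val x ⟨ha, hb⟩ u) := by
  rw [d0_eq_iff]
  refine forall₅_congr fun a b x ha hb => ContinuousLinearMap.ext_iff.trans <|
    forall_congr' fun s => (θ.flat_isInvertible x).injective.eq_iff.symm.trans <|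
    ContinuousLinearMap.ext_iff.trans <| forall_congr' fun u => ?_
  have flat_sub : θ.flat x (((k b).val x hb - (k a).val x ha) s) u =
      θ.flat x ((k b).val x hb s) u - θ.flat x ((k a).val x ha s) u := by
    rw [_root_.sub_apply, map_sub, _root_.sub_apply]
  have flat_sub_dual : θ.flat x (S.proj x ((e.1 a b).val x ⟨ha, hb⟩ s) -
        θ.sharp x ((HomMap.transpose U L).toFun x ((c.1 a b).val x ⟨ha, hb⟩) s)) u =
      θ.flat x (S.proj x ((e.1 a b).val x ⟨ha, hb⟩ s)) u -
        s ((c.1 a b).val x ⟨ha, hb⟩ u) := by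
    rw [map_sub, _root_.sub_apply, θ.sharp_transpose]
  exact Eq.congr flat_sub flat_sub_dual

theorem exists_d0_eq_sub_dualCocycle (hσ : S.IsSplitting σ c) (hτ : T.IsSplitting τ e)
    {Ω : SymplecticForm V} (hΩ : ∀ x, IsCompatible θ S T x (Ω.flat x)) :
    ∃ k : C0 L.dual U P, d0 L.dual U P k =
      (Z1.map (HomMap.postcomp L.dual S.proj) P e).1 - (θ.dualCocycle c).1 := by
  refine ⟨fun a => θ.mixedTerm (Ω.flat.toSec _) ((T.incl.toSec _).comp (σ a)) (τ a),
    d0_eq_sub_dualCocycle_iff.2 fun a b x ha hb s u => ?_⟩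
  rw [θ.flat_mixedTerm, θ.flat_mixedTerm]
  exact (hΩ x).apply_sub_apply_of_splitting (hσ.proj_apply b x hb) (hτ.proj_apply a x ha)
    (hσ.incl_apply a b x ha hb) (hτ.incl_apply a b x ha hb) s u

theorem exists_forall_isCompatible (hL : L.rank = 1) (hσ : S.IsSplitting σ c)
    (hτ : T.IsSplitting τ e) {k : C0 L.dual U P}
    (hk : d0 L.dual U P k =
      (Z1.map (HomMap.postcomp L.dual S.proj) P e).1 - (θ.dualCocycle c).1) :
    ∃ Ω : SymplecticForm V, ∀ x, IsCompatible θ S T x (Ω.flat x) := by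
  choose Ω hΩ hΩk using fun a =>
    exists_isCompatible (θ := θ) (hσ.proj_apply a) (hτ.proj_apply a) (k a)
  have d0_Ω : d0 V V.dual P Ω = 0 := d0_eq_iff.2 fun a b x ha hb => by
    refine sub_eq_zero.2 ((hΩ b x hb).ext hL (hΩ a x ha) (hσ.proj_apply b x hb)
      (hτ.proj_apply b x hb) fun s u => ?_)
    have change_Ω := (hΩ a x ha).apply_sub_apply_of_splitting (hσ.proj_apply b x hb)
      (hτ.proj_apply a x ha) (hσ.incl_apply a b x ha hb) (hτ.incl_apply a b x ha hb) s u
    have change_k := d0_eq_sub_dualCocycle_iff.1 hk a b x ha hb s u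
    rw [hΩk a x ha] at change_Ω
    rw [hΩk b x hb]
    linear_combination change_k - change_Ω
  obtain ⟨f, hf⟩ := exists_morphism_of_d0_eq_zero d0_Ω
  have hcomp x : IsCompatible θ S T x (f x) := by
    rw [hf x x (P.mem x)]
    exact hΩ x x (P.mem x)
  exact ⟨⟨f, fun x => (hcomp x).alternating, fun x _ => (hcomp x).nondegenerate⟩, hcomp⟩

end Gluing

end Symplectic

end HolBundle


theorem mainTheorem7_general {X : Type u} [TopologicalSpace X] [ChartedSpace ℂ X]
    (L : HolBundle.{u, v} X) (U : HolBundle.{u, w} X) (E : HolBundle.{u, w₁} X)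
    (V : HolBundle.{u, w₂} X) (hL : L.rank = 1) (θ : HolBundle.SymplecticForm U)
    (S : HolBundle.Extension L E U) (T : HolBundle.Extension E V L.dual) :
    (∃ Ω : HolBundle.SymplecticForm V,
      (∀ x, {v | ∀ l, Ω.flat x (T.incl x (S.incl x l)) v = 0} = range (T.incl x)) ∧
      (∀ x e e', Ω.flat x (T.incl x e) (T.incl x e') = θ.flat x (S.proj x e) (S.proj x e')) ∧
      (∀ x l v, Ω.flat x (T.incl x (S.incl x l)) v = T.proj x v l)) ↔
    HolBundle.Ext1.map (HolBundle.HomMap.postcomp L.dual S.proj) T.cls =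
      θ.dualClass S.cls := by
  obtain ⟨P, σ, c, hσ, hc⟩ := S.exists_isSplitting
  obtain ⟨Q, τ, e, hτ, he⟩ := T.exists_isSplitting
  obtain ⟨R, hPR, hQR⟩ := exists_ge_ge P Q
  rw [← hc, ← he, ← HolBundle.Ext1.mk_res hPR, ← HolBundle.Ext1.mk_res hQR,
    HolBundle.Ext1.map_mk, θ.dualClass_mk, HolBundle.Ext1.mk_eq_mk_iff]
  simp only [← HolBundle.forall_isCompatible_iff]
  constructor
  · rintro ⟨Ω, hΩ⟩
    obtain ⟨k, hk⟩ := HolBundle.exists_d0_eq_sub_dualCocycle (hσ.res hPR) (hτ.res hQR) hΩ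
    exact ⟨R, le_rfl, k, hk⟩
  · rintro ⟨R', hRR', k, hk⟩
    exact HolBundle.exists_forall_isCompatible hL ((hσ.res hPR).res hRR')
      ((hτ.res hQR).res hRR') hk

theorem mainTheorem7 {X : Type u} [TopologicalSpace X] [T2Space X] [CompactSpace X]
    [ConnectedSpace X] [ChartedSpace ℂ X] [IsManifold 𝓘(ℂ) ω X]
    (n : ℕ) (hn : 1 ≤ n)
    (L : HolBundle.{u, v} X) (U : HolBundle.{u, w} X) (E : HolBundle.{u, w₁} X)
    (V : HolBundle.{u, w₂} X)
    (hL : L.IsInvSqrtCanonical)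
    (hU : U.rank = 2 * n - 2) (θ : HolBundle.SymplecticForm U)
    (S : HolBundle.Extension L E U) (T : HolBundle.Extension E V L.dual) :
    (∃ Ω : HolBundle.SymplecticForm V,
      -- the orthogonal complement of `L` is `E`
      (∀ x, {v | ∀ l, Ω.flat x (T.incl x (S.incl x l)) v = 0} = range (T.incl x)) ∧
      -- the form induced on `E / L ≅ U` is `θ`
      (∀ x e e', Ω.flat x (T.incl x e) (T.incl x e') = θ.flat x (S.proj x e) (S.proj x e')) ∧
      -- the identification of `V / E` with `L⁻¹` induced by `Ω` is the given one
      (∀ x l v, Ω.flat x (T.incl x (S.incl x l)) v = T.proj x v l)) ↔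
    HolBundle.Ext1.map (HolBundle.HomMap.postcomp L.dual S.proj) T.cls =
      θ.dualClass S.cls :=
  mainTheorem7_general L U E V hL.1 θ S T
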